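/- Let $M$ be an $n$-dimensional complex manifold (a Hausdorff space with an atlas of charts to open subsets of $\mathbb C^n$ whose coordinate changes are holomorphic), let $\mathcal O_M$ be its sheaf of holomorphic functions, and let $k\ge 0$. For $p\in M$ let $(\wedge^kT^*)_p(M)$ be the space of continuous alternating $\mathbb C$-multilinear maps $T_p(M)^k\to\mathbb C$, and let $(\wedge^kT^*)(M)=\bigcup_{p}(\wedge^kT^*)_p(M)\to M$ be the holomorphic vector bundle they form, with the local trivializations induced by the charts of $M$. For $U\subset M$ open let $\Omega^k_M(U)$ be the $\mathcal O_M(U)$-module of holomorphic sections of this bundle over $U$. Then the sheaf of $\mathcal O_M$-modules $U\mapsto\Omega^k_M(U)$ is isomorphic, as a sheaf of $\mathcal O_M$-modules, to the classical sheaf of (germs of) holomorphic differential $k$-forms on $M$, i.e. of those sections $\omega$ of the exterior powers $\bigwedge^k (T_p(M))^*$, $p\in M$, of the cotangent spaces that in local holomorphic coordinates $(z^1,\dots,z^n)$ can be written as $\omega=\sum_{i_1<\dots<i_k} f_{i_1\dots i_k}\,dz^{i_1}\wedge\dots\wedge dz^{i_k}$ with holomorphic coefficients $f_{i_1\dots i_k}$.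 -/

import Mathlib

open scoped Manifold ContDiff

noncomputable section

namespace HolForms

open TopologicalSpace CategoryTheory Opposite

universe u

/-! ### Holomorphic maps on open subsets, and the structure sheaf

`M` is a manifold modelled on `ℂⁿ = Fin n → ℂ`; `MDifferentiable 𝓘(ℂ, Fin n → ℂ) I'` is complex
differentiability in charts, that is, holomorphy. -/

section Restriction

variable {n : ℕ} {M : Type u} [TopologicalSpace M] [ChartedSpace (Fin n → ℂ) M]
  {H' E' N : Type*} [NormedAddCommGroup E'] [NormedSpace ℂ E']
  [TopologicalSpace H'] {I' : ModelWithCorners ℂ E' H'} [TopologicalSpace N] [ChartedSpace H' N]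

/-- The restriction of a holomorphic map to a smaller open set is holomorphic. -/
theorem mdifferentiable_restrict {U V : Opens M} (h : U ≤ V) {f : V → N}
    (hf : MDifferentiable 𝓘(ℂ, Fin n → ℂ) I' f) :
    MDifferentiable 𝓘(ℂ, Fin n → ℂ) I' (fun x : U => f ⟨x.1, h x.2⟩) := fun x =>
  (differentiableWithinAt_localInvariantProp.liftPropAt_iff_comp_inclusion h f x).1
    (hf (Set.inclusion h x))

/-- A map that is holomorphic near every point is holomorphic. -/
theorem mdifferentiable_of_local {V : Opens M} {f : V → N}
    (hf : ∀ x : V, ∃ (U : Opens M) (h : U ≤ V), x.1 ∈ U ∧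
      MDifferentiable 𝓘(ℂ, Fin n → ℂ) I' (fun x : U => f ⟨x.1, h x.2⟩)) :
    MDifferentiable 𝓘(ℂ, Fin n → ℂ) I' f := by
  intro x
  obtain ⟨U, h, hx, hU⟩ := hf x
  exact (differentiableWithinAt_localInvariantProp.liftPropAt_iff_comp_inclusion h f ⟨x.1, hx⟩).2
    (hU ⟨x.1, hx⟩)

end Restriction

section StructureSheaf

variable (n : ℕ) (M : Type u) [TopologicalSpace M] [ChartedSpace (Fin n → ℂ) M]

/-- The ring `𝒪_M(U)` of holomorphic functions on an open subset `U` of `M`. -/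
def holRing (U : Opens M) : Subring (U → ℂ) where
  carrier := {f | MDifferentiable 𝓘(ℂ, Fin n → ℂ) 𝓘(ℂ, ℂ) f}
  mul_mem' hf hg := MDifferentiable.mul hf hg
  one_mem' := mdifferentiable_const
  add_mem' hf hg := MDifferentiable.add hf hg
  zero_mem' := mdifferentiable_const
  neg_mem' hf := MDifferentiable.neg hf

/-- Holomorphy of complex valued functions is a local condition. -/
def holFun : TopCat.LocalPredicate (X := TopCat.of M) (fun _ => ℂ) where
  pred {U} f := f ∈ holRing n M U
  res i _ hf := mdifferentiable_restrict i.le hf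
  locality {U} f hf := by
    refine mdifferentiable_of_local fun x => ?_
    obtain ⟨V, hx, i, hV⟩ := hf x
    exact ⟨V, i.le, hx, hV⟩

/-- The sheaf of rings `𝒪_M` of holomorphic functions on `M`. -/
def structureSheaf : TopCat.Sheaf RingCat.{u} (TopCat.of M) where
  obj :=
    { obj := fun U => RingCat.of (holRing n M (unop U))
      map := fun {U V} i => RingCat.ofHom
        { toFun := fun f => ⟨fun x => f.1 ⟨x.1, i.unop.le x.2⟩,
            mdifferentiable_restrict i.unop.le f.2⟩
          map_one' := rfl
          map_mul' := fun _ _ => rfl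
          map_zero' := rfl
          map_add' := fun _ _ => rfl }
      map_id := fun _ => rfl
      map_comp := fun _ _ => rfl }
  property := by
    rw [CategoryTheory.Presheaf.isSheaf_iff_isSheaf_forget _ _ (CategoryTheory.forget RingCat)]
    exact (TopCat.subsheafToTypes (holFun n M)).property

/-- The category of sheaves of `𝒪_M`-modules: Mathlib's, with its universe levels made explicit. -/
instance instCategoryModules : Category.{u, u + 1} (SheafOfModules.{u} (structureSheaf n M)) :=
  SheafOfModules.instCategory

/-! ### Sheaves of `𝒪_M`-modules consisting of dependent functions -/

/-- For a family `T x` of complex vector spaces indexed by `x : M`: for each open `U`, an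
`𝒪_M(U)`-submodule of `∏_{x ∈ U} T x`, stable under restriction and defined by a local condition. -/
structure LocalModule (T : M → Type) [∀ x, AddCommGroup (T x)] [∀ x, Module ℂ (T x)] where
  /-- the module of sections over `U` -/
  sec (U : Opens M) : Submodule (holRing n M U) ((x : U) → T x)
  res {U V : Opens M} (h : U ≤ V) {s : (x : V) → T x} (hs : s ∈ sec V) :
    (fun x : U => s ⟨x.1, h x.2⟩) ∈ sec U
  locality {V : Opens M} (s : (x : V) → T x)
    (hs : ∀ x : V, ∃ (U : Opens M) (h : U ≤ V), x.1 ∈ U ∧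
      (fun x : U => s ⟨x.1, h x.2⟩) ∈ sec U) : s ∈ sec V

variable {n M}
variable {T : M → Type} [∀ x, AddCommGroup (T x)] [∀ x, Module ℂ (T x)]

/-- The underlying presheaf of abelian groups, with restriction of functions. -/
def LocalModule.presheafAb (F : LocalModule n M T) : (Opens (TopCat.of M))ᵒᵖ ⥤ Ab.{u} where
  obj U := AddCommGrpCat.of (F.sec (unop U))
  map i := AddCommGrpCat.ofHom
    { toFun := fun s => ⟨fun x => s.1 ⟨x.1, i.unop.le x.2⟩, F.res i.unop.le s.2⟩
      map_zero' := rfl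
      map_add' := fun _ _ => rfl }
  map_id _ := rfl
  map_comp _ _ := rfl

instance LocalModule.instModulePresheafAb (F : LocalModule n M T) (U : (Opens (TopCat.of M))ᵒᵖ) :
    Module ((structureSheaf n M).obj.obj U) (F.presheafAb.obj U) :=
  inferInstanceAs (Module (holRing n M (unop U)) (F.sec (unop U)))

theorem LocalModule.isSheaf (F : LocalModule n M T) :
    Presheaf.IsSheaf (Opens.grothendieckTopology (TopCat.of M)) F.presheafAb := by
  rw [CategoryTheory.Presheaf.isSheaf_iff_isSheaf_forget _ _ (CategoryTheory.forget Ab)]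
  exact (TopCat.subsheafToTypes (X := TopCat.of M) (T := T)
      { pred := fun {U} s => s ∈ F.sec U
        res := fun i _ hs => F.res i.le hs
        locality := fun {U} s hs => F.locality s fun x => by
          obtain ⟨V, hx, i, hV⟩ := hs x
          exact ⟨V, i.le, hx, hV⟩ }).property

/-- The sheaf of `𝒪_M`-modules `U ↦ F.sec U`. -/
def LocalModule.toSheaf (F : LocalModule n M T) : SheafOfModules.{u} (structureSheaf n M) where
  val := PresheafOfModules.ofPresheaf F.presheafAb (fun _ _ _ _ _ => rfl)
  isSheaf := F.isSheaf

end StructureSheaf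

/-! ### The classical sheaf of holomorphic differential `k`-forms -/

section Classical

variable (n k : ℕ) (M : Type u) [TopologicalSpace M] [ChartedSpace (Fin n → ℂ) M]

/-- The `k`-th exterior power `⋀ᵏ (T_x M)*` of the holomorphic cotangent space at `x`. -/
def ExtFiber (x : M) : Type :=
  ⋀[ℂ]^k (Module.Dual ℂ (TangentSpace 𝓘(ℂ, Fin n → ℂ) x))

instance (x : M) : AddCommGroup (ExtFiber n k M x) :=
  inferInstanceAs (AddCommGroup (⋀[ℂ]^k (Module.Dual ℂ (TangentSpace 𝓘(ℂ, Fin n → ℂ) x))))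

instance (x : M) : Module ℂ (ExtFiber n k M x) :=
  inferInstanceAs (Module ℂ (⋀[ℂ]^k (Module.Dual ℂ (TangentSpace 𝓘(ℂ, Fin n → ℂ) x))))

variable {n k M}

/-- For a chart `e = (z¹, …, zⁿ)` of `M`, the differential `dzⁱ` at a point `x` of its domain. -/
def dz (e : OpenPartialHomeomorph M (Fin n → ℂ)) (i : Fin n) (x : M) :
    Module.Dual ℂ (TangentSpace 𝓘(ℂ, Fin n → ℂ) x) :=
  (mfderiv 𝓘(ℂ, Fin n → ℂ) 𝓘(ℂ, ℂ) (fun y => e y i) x :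
    TangentSpace 𝓘(ℂ, Fin n → ℂ) x →L[ℂ] ℂ).toLinearMap

/-- `dz^{i₁} ∧ ⋯ ∧ dz^{i_k}` at `x`, for a multi-index `i₁ < ⋯ < i_k`. -/
def dzWedge (e : OpenPartialHomeomorph M (Fin n → ℂ)) (I : Fin k ↪o Fin n) (x : M) :
    ExtFiber n k M x :=
  exteriorPower.ιMulti ℂ k (fun j => dz e (I j) x)

/-- `s` is a holomorphic differential `k`-form on `U`: in every local coordinate system
`(z¹, …, zⁿ)`, it can be written locally as `∑_{i₁ < ⋯ < i_k} f_I dz^{i₁} ∧ ⋯ ∧ dz^{i_k}` with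
holomorphic coefficients `f_I`. -/
def IsHolForm {U : Opens M} (s : (x : U) → ExtFiber n k M x) : Prop :=
  ∀ e ∈ atlas (Fin n → ℂ) M, ∀ p : U, (p : M) ∈ e.source →
    ∃ (V : Opens M) (hV : V ≤ U), (p : M) ∈ V ∧ (V : Set M) ⊆ e.source ∧
      ∃ f : (Fin k ↪o Fin n) → holRing n M V,
        ∀ x : V, s ⟨x, hV x.2⟩ = ∑ I, (f I).1 x • dzWedge e I (x : M)

variable (n k M)

/-- The modules of holomorphic differential `k`-forms on the open subsets of `M`. -/
def holForms : LocalModule n M (ExtFiber n k M) where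
  sec U :=
    { carrier := {s | IsHolForm s}
      add_mem' := by
        intro s t hs ht e he p hp
        obtain ⟨V, hV, hpV, hVe, f, hf⟩ := hs e he p hp
        obtain ⟨W, hW, hpW, hWe, g, hg⟩ := ht e he p hp
        refine ⟨V ⊓ W, inf_le_left.trans hV, ⟨hpV, hpW⟩, fun x hx => hVe hx.1, fun I =>
          ⟨fun x => (f I).1 ⟨x, x.2.1⟩ + (g I).1 ⟨x, x.2.2⟩,
            (mdifferentiable_restrict inf_le_left (f I).2).add
              (mdifferentiable_restrict inf_le_right (g I).2)⟩, fun x => ?_⟩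
        simp only [add_smul, Finset.sum_add_distrib]
        rw [← hf ⟨x, x.2.1⟩, ← hg ⟨x, x.2.2⟩]
        rfl
      zero_mem' := by
        intro e he p hp
        refine ⟨U ⊓ ⟨e.source, e.open_source⟩, inf_le_left, ⟨p.2, hp⟩, fun x hx => hx.2,
          fun I => 0, fun x => ?_⟩
        exact (Finset.sum_eq_zero fun I _ => zero_smul ℂ _).symm
      smul_mem' := by
        rintro h s hs e he p hp
        obtain ⟨V, hV, hpV, hVe, f, hf⟩ := hs e he p hp
        refine ⟨V, hV, hpV, hVe, fun I =>
          ⟨fun x => h.1 ⟨x, hV x.2⟩, mdifferentiable_restrict hV h.2⟩ * f I, fun x => ?_⟩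
        have : (h • s) ⟨x, hV x.2⟩ = h.1 ⟨x, hV x.2⟩ • s ⟨x, hV x.2⟩ := rfl
        rw [this, hf x, Finset.smul_sum]
        refine Finset.sum_congr rfl fun I _ => ?_
        rw [smul_smul]
        rfl }
  res {U V} h s hs e he p hp := by
    obtain ⟨W, hW, hpW, hWe, f, hf⟩ := hs e he ⟨p, h p.2⟩ hp
    refine ⟨U ⊓ W, inf_le_left, ⟨p.2, hpW⟩, fun x hx => hWe hx.2, fun I =>
      ⟨fun x => (f I).1 ⟨x, x.2.2⟩, mdifferentiable_restrict inf_le_right (f I).2⟩,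
      fun x => hf ⟨x, x.2.2⟩⟩
  locality {V} s hs e he p hp := by
    obtain ⟨U, h, hpU, hU⟩ := hs p
    obtain ⟨W, hW, hpW, hWe, f, hf⟩ := hU e he ⟨p, hpU⟩ hp
    exact ⟨W, hW.trans h, hpW, hWe, f, hf⟩

/-- The classical sheaf of `𝒪_M`-modules of (germs of) holomorphic differential `k`-forms. -/
def classicalFormSheaf : SheafOfModules.{u} (structureSheaf n M) :=
  (holForms n k M).toSheaf

end Classical

/-! ### Holomorphic sections of the bundle of continuous alternating `k`-forms -/

section Alternating

variable (n k : ℕ) (M : Type u) [TopologicalSpace M] [ChartedSpace (Fin n → ℂ) M]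

/-- The space of continuous alternating `ℂ`-multilinear `k`-forms on `T_x M`. -/
abbrev AltFiber (x : M) : Type :=
  TangentSpace 𝓘(ℂ, Fin n → ℂ) x [⋀^Fin k]→L[ℂ] Bundle.Trivial M ℂ x

/-- The model fibre: continuous alternating `k`-forms on `ℂⁿ`, with the operator norm. -/
abbrev AltModel : Type := (Fin n → ℂ) [⋀^Fin k]→L[ℂ] ℂ

/-- The total space of the bundle of continuous alternating `k`-forms. Topology, vector bundle
structure and charts come from Mathlib: a chart of `M` trivializes the tangent bundle, hence this
bundle, by pulling back forms. -/
abbrev AltBundle : Type u := Bundle.TotalSpace (AltModel n k) (AltFiber n k M)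

variable [IsManifold 𝓘(ℂ, Fin n → ℂ) ω M]

variable {n k M}

/-- `s` is a holomorphic section over `U`: it is holomorphic as a map from `U` to the total
space. -/
def IsHolSection {U : Opens M} (s : (x : U) → AltFiber n k M x) : Prop :=
  MDifferentiable 𝓘(ℂ, Fin n → ℂ) (𝓘(ℂ, Fin n → ℂ).prod 𝓘(ℂ, AltModel n k))
    (fun x : U => (Bundle.TotalSpace.mk' (AltModel n k) (x : M) (s x) : AltBundle n k M))

theorem isHolSection_iff {U : Opens M} (s : (x : U) → AltFiber n k M x) :
    IsHolSection s ↔ ∀ x₀ : U, MDifferentiableAt 𝓘(ℂ, Fin n → ℂ) 𝓘(ℂ, AltModel n k)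
      (fun x : U => ((trivializationAt (AltModel n k) (AltFiber n k M) (x₀ : M))
        ⟨(x : M), s x⟩).2) x₀ := by
  refine forall_congr' fun x₀ => ?_
  rw [mdifferentiableAt_totalSpace]
  refine and_iff_right ?_
  exact (contMDiff_subtype_val (n := 1) x₀).mdifferentiableAt one_ne_zero

theorem eventually_mem_base {U : Opens M} (x₀ : U) :
    ∀ᶠ x : U in nhds x₀,
      (x : M) ∈ (trivializationAt (AltModel n k) (AltFiber n k M) (x₀ : M)).baseSet :=
  continuous_subtype_val.continuousAt.eventually_mem
    ((trivializationAt (AltModel n k) (AltFiber n k M) (x₀ : M)).open_baseSet.mem_nhds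
      (FiberBundle.mem_baseSet_trivializationAt' _))

variable (n k M)

/-- The modules of holomorphic sections over the open subsets of `M`. -/
def altForms : LocalModule n M (AltFiber n k M) where
  sec U :=
    { carrier := {s | IsHolSection s}
      add_mem' := by
        intro s t hs ht
        simp only [Set.mem_ofPred_eq, isHolSection_iff] at hs ht ⊢
        intro x₀
        refine ((hs x₀).add (ht x₀)).congr_of_eventuallyEq ?_
        filter_upwards [eventually_mem_base (n := n) (k := k) x₀] with x hx
        exact ((trivializationAt (AltModel n k) (AltFiber n k M) (x₀ : M)).linear ℂ hx).map_add _ _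
      zero_mem' := by
        simp only [Set.mem_ofPred_eq, isHolSection_iff]
        intro x₀
        refine (mdifferentiableAt_const (c := (0 : AltModel n k))).congr_of_eventuallyEq ?_
        filter_upwards [eventually_mem_base (n := n) (k := k) x₀] with x hx
        exact ((trivializationAt (AltModel n k) (AltFiber n k M) (x₀ : M)).linear ℂ hx).map_zero
      smul_mem' := by
        rintro ⟨f, hf⟩ s hs
        simp only [Set.mem_ofPred_eq, isHolSection_iff] at hs ⊢
        intro x₀
        refine ((hf x₀).smul (hs x₀)).congr_of_eventuallyEq ?_
        filter_upwards [eventually_mem_base (n := n) (k := k) x₀] with x hx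
        exact ((trivializationAt (AltModel n k) (AltFiber n k M) (x₀ : M)).linear ℂ hx).map_smul
          (f x) (s x) }
  res h _ hs := mdifferentiable_restrict h hs
  locality _ hs := mdifferentiable_of_local hs

/-- The sheaf of `𝒪_M`-modules `U ↦ Ωᵏ_M(U)` of holomorphic sections of the bundle of continuous
alternating `k`-forms on the tangent spaces. -/
def altFormSheaf : SheafOfModules.{u} (structureSheaf n M) :=
  (altForms n k M).toSheaf

end Alternating

end HolForms

end

/-! For a finite-dimensional vector space `V`, pairing the basis of `⋀ᵏ V*` built from a dual basis
with the corresponding basis of `⋀ᵏ V` shows that `⋀ᵏ V* → (⋀ᵏ V)*` is bijective, so `⋀ᵏ V*` is the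
space of alternating `k`-forms on `V`, all of which are continuous. On the tangent spaces of `M`
this gives fibrewise isomorphisms, and it remains to match holomorphy on the two sides. In a chart
`(z¹, …, zⁿ)` the coefficient of `dz^{i₁} ∧ ⋯ ∧ dz^{i_k}` in a form is its value on the coordinate
vector fields `∂/∂z^{i₁}, …, ∂/∂z^{i_k}`. These fields are holomorphic, and a chart of `M`
trivializes the tangent bundle by sending them to the standard basis; hence both for sections of
the bundle of alternating forms and for classical differential forms, holomorphy means that these
coefficients are holomorphic in every chart. -/

noncomputable section

namespace HolForms

open TopologicalSpace CategoryTheory Opposite Module Bundle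

universe u

/-! ### Exterior powers of the dual and alternating forms -/

section ExteriorPower

variable {R V ι : Type*} [CommRing R] [AddCommGroup V] [Module R V] [LinearOrder ι] {k : ℕ}

variable (k) in
/-- The basis `b i₁ ∧ ⋯ ∧ b i_k`, `i₁ < ⋯ < i_k`, of the `k`-th exterior power, indexed by
increasing multi-indices instead of Mathlib's `k`-element subsets, to match `dzWedge`. -/
def wedgeBasis (b : Basis ι R V) : Basis (Fin k ↪o ι) R (⋀[R]^k V) :=
  (b.exteriorPower k).reindex Set.powersetCard.ofFinEmbEquiv.symm

theorem wedgeBasis_apply (b : Basis ι R V) (I : Fin k ↪o ι) :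
    wedgeBasis k b I = exteriorPower.ιMulti R k fun j => b (I j) := by
  simp [wedgeBasis, exteriorPower.ιMulti_family, Function.comp_def]

theorem wedgeBasis_coord (b : Basis ι R V) (I : Fin k ↪o ι) :
    (wedgeBasis k b).coord I =
      exteriorPower.pairingDual R V k (exteriorPower.ιMulti R k fun j => b.coord (I j)) := by
  ext w
  simp [wedgeBasis, exteriorPower.basis_repr_apply, exteriorPower.ιMultiDual,
    exteriorPower.ιMulti_family, Function.comp_def]

instance instFiniteOrderEmbedding {α β : Type*} [LE α] [LE β] [Finite α] [Finite β] :
    Finite (α ↪o β) :=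
  DFunLike.finite _

variable [Finite ι]

theorem pairingDual_wedgeBasis_dualBasis (b : Basis ι R V) (I : Fin k ↪o ι) :
    exteriorPower.pairingDual R V k (wedgeBasis k b.dualBasis I) =
      (wedgeBasis k b).dualBasis I := by
  rw [wedgeBasis_apply, Basis.coe_dualBasis, Basis.coe_dualBasis, wedgeBasis_coord]

theorem pairingDual_bijective (b : Basis ι R V) :
    Function.Bijective (exteriorPower.pairingDual R V k) := by
  have h : ((wedgeBasis k b.dualBasis).equiv (wedgeBasis k b).dualBasis (.refl _)).toLinearMap =
      exteriorPower.pairingDual R V k :=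
    (wedgeBasis k b.dualBasis).ext fun I => by simp [pairingDual_wedgeBasis_dualBasis]
  rw [← h]
  exact LinearEquiv.bijective _

theorem wedgeBasis_dualBasis_repr_apply (b : Basis ι R V) (w : ⋀[R]^k (Dual R V))
    (I : Fin k ↪o ι) :
    (wedgeBasis k b.dualBasis).repr w I =
      exteriorPower.pairingDual R V k w (wedgeBasis k b I) := by
  have h : (wedgeBasis k b.dualBasis).coord I =
      (exteriorPower.pairingDual R V k).flip (wedgeBasis k b I) :=
    (wedgeBasis k b.dualBasis).ext fun J => by
      simp [pairingDual_wedgeBasis_dualBasis, Finsupp.single_apply, eq_comm]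
  exact congr($h w)

end ExteriorPower

section ContinuousAlternating

variable {𝕜 : Type*} [NontriviallyNormedField 𝕜] [CompleteSpace 𝕜]

theorem continuous_multilinearMap_of_finiteDimensional {ι F : Type*} {V : ι → Type*} [Finite ι]
    [∀ i, AddCommGroup (V i)] [∀ i, Module 𝕜 (V i)] [∀ i, TopologicalSpace (V i)]
    [∀ i, IsTopologicalAddGroup (V i)] [∀ i, ContinuousSMul 𝕜 (V i)] [∀ i, T2Space (V i)]
    [∀ i, FiniteDimensional 𝕜 (V i)] [AddCommGroup F] [Module 𝕜 F] [TopologicalSpace F]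
    [ContinuousAdd F] [ContinuousSMul 𝕜 F] (f : MultilinearMap 𝕜 V F) : Continuous f := by
  classical
  have := Fintype.ofFinite ι
  let b i := finBasis 𝕜 (V i)
  have hf (v) : f v = ∑ r : (i : ι) → Fin (finrank 𝕜 (V i)),
      (∏ i, (b i).coord (r i) (v i)) • f fun i => b i (r i) := by
    calc f v = f fun i => ∑ j, (b i).coord j (v i) • b i j := by
          simp only [Basis.coord_apply, Basis.sum_repr]
      _ = _ := by simp only [f.map_sum, f.map_smul_univ]
  rw [funext hf]
  refine continuous_finsetSum _ fun r _ =>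
    .smul (continuous_finsetProd _ fun i _ => ?_) continuous_const
  exact ((b i).coord (r i)).continuous_of_finiteDimensional.comp (continuous_apply i)

variable {V : Type*} [AddCommGroup V] [Module 𝕜 V] [TopologicalSpace V]
  [IsTopologicalAddGroup V] [ContinuousSMul 𝕜 V] [T2Space V] [FiniteDimensional 𝕜 V]

/-- The identification of algebraic and continuous alternating maps on a finite-dimensional
space. -/
def alternatingMapEquivContinuous {F ι : Type*} [Fintype ι] [AddCommGroup F] [Module 𝕜 F]
    [TopologicalSpace F] [IsTopologicalAddGroup F] [ContinuousSMul 𝕜 F] :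
    (V [⋀^ι]→ₗ[𝕜] F) ≃ₗ[𝕜] V [⋀^ι]→L[𝕜] F where
  toFun f :=
    { f with cont := continuous_multilinearMap_of_finiteDimensional f.toMultilinearMap }
  invFun f := f.toAlternatingMap
  map_add' _ _ := rfl
  map_smul' _ _ := rfl
  left_inv _ := rfl
  right_inv _ := rfl

variable (𝕜 V) in
/-- The identification of `⋀ᵏ V*` with the continuous alternating `k`-forms on a
finite-dimensional space `V`, normalized so that `φ₁ ∧ ⋯ ∧ φ_k` is sent to
`v ↦ det (φ i (v j))`, without a factor `1 / k!`. -/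
def wedgeEquivAlternating (k : ℕ) : (⋀[𝕜]^k (Dual 𝕜 V)) ≃ₗ[𝕜] V [⋀^Fin k]→L[𝕜] 𝕜 :=
  .ofBijective _ (pairingDual_bijective (finBasis 𝕜 V)) ≪≫ₗ
    exteriorPower.alternatingMapLinearEquiv.symm ≪≫ₗ alternatingMapEquivContinuous

variable {ι : Type*} [LinearOrder ι] {k : ℕ}

theorem wedgeEquivAlternating_apply_basis [Finite ι] (b : Basis ι 𝕜 V) (w : ⋀[𝕜]^k (Dual 𝕜 V))
    (I : Fin k ↪o ι) :
    wedgeEquivAlternating 𝕜 V k w (fun j => b (I j)) = (wedgeBasis k b.dualBasis).repr w I := by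
  rw [wedgeBasis_dualBasis_repr_apply, wedgeBasis_apply]
  rfl

theorem sum_apply_basis_smul_wedgeEquivAlternating [Fintype ι] (b : Basis ι 𝕜 V)
    (f : V [⋀^Fin k]→L[𝕜] 𝕜) :
    ∑ I : Fin k ↪o ι, f (fun j => b (I j)) •
      wedgeEquivAlternating 𝕜 V k (wedgeBasis k b.dualBasis I) = f := by
  obtain ⟨w, rfl⟩ := (wedgeEquivAlternating 𝕜 V k).surjective f
  simp only [wedgeEquivAlternating_apply_basis, ← map_smul, ← map_sum, Basis.sum_repr]

end ContinuousAlternating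

/-! ### Differentiability of families of alternating maps -/

section AlternatingFamilies

variable {𝕜 E H N F ι : Type*} [NontriviallyNormedField 𝕜] [NormedAddCommGroup E]
  [NormedSpace 𝕜 E] [TopologicalSpace H] {I : ModelWithCorners 𝕜 E H} [TopologicalSpace N]
  [ChartedSpace H N] [NormedAddCommGroup F] [NormedSpace 𝕜 F] [Fintype ι] {x : N}

theorem mdifferentiableAt_pi_space {f : N → ι → F} :
    MDifferentiableAt I 𝓘(𝕜, ι → F) f x ↔
      ∀ i, MDifferentiableAt I 𝓘(𝕜, F) (fun y => f y i) x := by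
  simp only [mdifferentiableAt_iff, continuousAt_pi, forall_and]
  exact and_congr_right' differentiableWithinAt_pi

theorem mdifferentiableAt_alternating_apply {F' : Type*} [NormedAddCommGroup F']
    [NormedSpace 𝕜 F'] {f : N → F [⋀^ι]→L[𝕜] F'} {v : ι → N → F}
    (hf : MDifferentiableAt I 𝓘(𝕜, F [⋀^ι]→L[𝕜] F') f x)
    (hv : ∀ i, MDifferentiableAt I 𝓘(𝕜, F) (v i) x) :
    MDifferentiableAt I 𝓘(𝕜, F') (fun y => f y fun i => v i y) x := by
  have h : Differentiable 𝕜 fun q : (F [⋀^ι]→L[𝕜] F') × (ι → F) => q.1 fun i => q.2 i :=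
    differentiable_fst.continuousAlternatingMap_apply fun i =>
      differentiable_pi.1 differentiable_snd i
  exact h.comp_mdifferentiableAt (hf.prodMk_space (mdifferentiableAt_pi_space.2 hv))

theorem mdifferentiableAt_alternating_of_apply_basis [CompleteSpace 𝕜] [FiniteDimensional 𝕜 F]
    {κ : Type*} [Finite κ] [LinearOrder κ] {k : ℕ} (b : Basis κ 𝕜 F)
    {f : N → F [⋀^Fin k]→L[𝕜] 𝕜}
    (hf : ∀ J : Fin k ↪o κ, MDifferentiableAt I 𝓘(𝕜, 𝕜) (fun y => f y fun j => b (J j)) x) :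
    MDifferentiableAt I 𝓘(𝕜, F [⋀^Fin k]→L[𝕜] 𝕜) f x := by
  have := Fintype.ofFinite κ
  let L : ((Fin k ↪o κ) → 𝕜) →L[𝕜] F [⋀^Fin k]→L[𝕜] 𝕜 :=
    (Fintype.linearCombination 𝕜 fun J =>
      wedgeEquivAlternating 𝕜 F k (wedgeBasis k b.dualBasis J)).toContinuousLinearMap
  have hL : f = L ∘ fun y J => f y fun j => b (J j) :=
    funext fun y => (sum_apply_basis_smul_wedgeEquivAlternating b (f y)).symm
  rw [hL]
  exact L.differentiable.comp_mdifferentiableAt (mdifferentiableAt_pi_space.2 hf)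

end AlternatingFamilies

section AlternatingBundle

theorem eventually_mem_baseSet {M B : Type*} [TopologicalSpace M] [TopologicalSpace B]
    (F : Type*) [TopologicalSpace F] (E : B → Type*) [∀ x, TopologicalSpace (E x)]
    [TopologicalSpace (TotalSpace F E)] [FiberBundle F E] {b : M → B} {x : M}
    (hb : ContinuousAt b x) : ∀ᶠ m in nhds x, b m ∈ (trivializationAt F E (b x)).baseSet :=
  hb.eventually_mem ((trivializationAt F E (b x)).open_baseSet.mem_nhds
    (FiberBundle.mem_baseSet_trivializationAt F E (b x)))

variable {𝕜 EB HB B EM HM M F₁ F₂ ι : Type*} [NontriviallyNormedField 𝕜] [Fintype ι]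
  [NormedAddCommGroup EB] [NormedSpace 𝕜 EB] [TopologicalSpace HB]
  {IB : ModelWithCorners 𝕜 EB HB} [TopologicalSpace B] [ChartedSpace HB B]
  [NormedAddCommGroup EM] [NormedSpace 𝕜 EM] [TopologicalSpace HM]
  {IM : ModelWithCorners 𝕜 EM HM} [TopologicalSpace M] [ChartedSpace HM M]
  [NormedAddCommGroup F₁] [NormedSpace 𝕜 F₁] {E₁ : B → Type*} [∀ x, AddCommGroup (E₁ x)]
  [∀ x, Module 𝕜 (E₁ x)] [TopologicalSpace (TotalSpace F₁ E₁)] [∀ x, TopologicalSpace (E₁ x)]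
  [FiberBundle F₁ E₁] [VectorBundle 𝕜 F₁ E₁]
  [NormedAddCommGroup F₂] [NormedSpace 𝕜 F₂] {E₂ : B → Type*} [∀ x, AddCommGroup (E₂ x)]
  [∀ x, Module 𝕜 (E₂ x)] [TopologicalSpace (TotalSpace F₂ E₂)] [∀ x, TopologicalSpace (E₂ x)]
  [FiberBundle F₂ E₂] [VectorBundle 𝕜 F₂ E₂]
  [∀ x, IsTopologicalAddGroup (E₂ x)] [∀ x, ContinuousSMul 𝕜 (E₂ x)]

theorem mdifferentiableAt_alternating_bundle_apply {b : M → B} {x : M}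
    {φ : ∀ m, E₁ (b m) [⋀^ι]→L[𝕜] E₂ (b m)} {v : ι → ∀ m, E₁ (b m)}
    (hφ : MDifferentiableAt IM (IB.prod 𝓘(𝕜, F₁ [⋀^ι]→L[𝕜] F₂))
      (fun m => TotalSpace.mk' (F₁ [⋀^ι]→L[𝕜] F₂) (E := fun y => E₁ y [⋀^ι]→L[𝕜] E₂ y)
        (b m) (φ m)) x)
    (hv : ∀ i, MDifferentiableAt IM (IB.prod 𝓘(𝕜, F₁))
      (fun m => TotalSpace.mk' F₁ (b m) (v i m)) x) :
    MDifferentiableAt IM (IB.prod 𝓘(𝕜, F₂))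
      (fun m => TotalSpace.mk' F₂ (b m) (φ m fun i => v i m)) x := by
  simp only [mdifferentiableAt_totalSpace] at hφ hv ⊢
  refine ⟨hφ.1,
    (mdifferentiableAt_alternating_apply hφ.2 fun i => (hv i).2).congr_of_eventuallyEq ?_⟩
  filter_upwards [eventually_mem_baseSet F₁ E₁ hφ.1.continuousAt,
    eventually_mem_baseSet F₂ E₂ hφ.1.continuousAt] with m hm₁ hm₂
  rw [FiberBundle.trivializationAt_continuousAlternatingMap_apply,
    ContinuousAlternatingMap.inCoordinates_eq F₁ F₂ hm₁ hm₂]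
  simp [hm₁, Function.comp_def]

end AlternatingBundle

/-! ### Coordinate vector fields -/

section CoordinateFields

variable {n k : ℕ} {M : Type u} [TopologicalSpace M] [ChartedSpace (Fin n → ℂ) M]
  {e : OpenPartialHomeomorph M (Fin n → ℂ)} {x x₀ : M}

/-- For a chart `e = (z¹, …, zⁿ)` of `M`, the vector field `∂/∂zⁱ`: the pullback under `e` of a
constant field. It is meaningful only on the domain of `e`. -/
def coordField (e : OpenPartialHomeomorph M (Fin n → ℂ)) (i : Fin n) (x : M) :
    TangentSpace 𝓘(ℂ, Fin n → ℂ) x :=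
  VectorField.mpullback 𝓘(ℂ, Fin n → ℂ) 𝓘(ℂ, Fin n → ℂ) e (fun _ => Pi.single i 1) x

/-- The basis `∂/∂z¹, …, ∂/∂zⁿ` of the tangent space at a point in the domain of a chart. -/
def coordBasis (he : e.MDifferentiable 𝓘(ℂ, Fin n → ℂ) 𝓘(ℂ, Fin n → ℂ)) (hx : x ∈ e.source) :
    Basis (Fin n) ℂ (TangentSpace 𝓘(ℂ, Fin n → ℂ) x) :=
  (Pi.basisFun ℂ (Fin n)).map (he.mfderiv hx).symm.toLinearEquiv

theorem coordBasis_apply (he : e.MDifferentiable 𝓘(ℂ, Fin n → ℂ) 𝓘(ℂ, Fin n → ℂ))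
    (hx : x ∈ e.source) (i : Fin n) : coordBasis he hx i = coordField e i x := by
  have h : (mfderiv 𝓘(ℂ, Fin n → ℂ) 𝓘(ℂ, Fin n → ℂ) e x).inverse = (he.mfderiv hx).symm :=
    ContinuousLinearMap.inverse_equiv (he.mfderiv hx)
  calc coordBasis he hx i = (he.mfderiv hx).symm (Pi.basisFun ℂ (Fin n) i) := rfl
    _ = (he.mfderiv hx).symm (Pi.single i 1) :=
      congrArg (he.mfderiv hx).symm (Pi.basisFun_apply ℂ (Fin n) i)
    _ = coordField e i x := congr($h.symm (Pi.single i 1))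

theorem coordBasis_coord (he : e.MDifferentiable 𝓘(ℂ, Fin n → ℂ) 𝓘(ℂ, Fin n → ℂ))
    (hx : x ∈ e.source) (i : Fin n) : (coordBasis he hx).coord i = dz e i x := by
  let pr : (Fin n → ℂ) →L[ℂ] ℂ := .proj i
  have h : HasMFDerivAt 𝓘(ℂ, Fin n → ℂ) 𝓘(ℂ, ℂ) (fun y => e y i) x
      (pr.comp (mfderiv 𝓘(ℂ, Fin n → ℂ) 𝓘(ℂ, Fin n → ℂ) e x)) :=
    pr.hasMFDerivAt.comp x (he.mdifferentiableAt hx).hasMFDerivAt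
  rw [dz, h.mfderiv]
  rfl

variable [IsManifold 𝓘(ℂ, Fin n → ℂ) ω M]

theorem mdifferentiableAt_coordField (he : e ∈ atlas (Fin n → ℂ) M) (hx : x ∈ e.source)
    (i : Fin n) :
    MDifferentiableAt 𝓘(ℂ, Fin n → ℂ) 𝓘(ℂ, Fin n → ℂ).tangent
      (fun y => (⟨y, coordField e i y⟩ : TangentBundle 𝓘(ℂ, Fin n → ℂ) M)) x := by
  have hconst : MDifferentiableAt 𝓘(ℂ, Fin n → ℂ) 𝓘(ℂ, Fin n → ℂ).tangent
      (fun y => (⟨y, Pi.single i 1⟩ : TangentBundle 𝓘(ℂ, Fin n → ℂ) (Fin n → ℂ))) (e x) :=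
    (contMDiffAt_vectorSpace_iff_contDiffAt (n := 1).2 contDiffAt_const).mdifferentiableAt
      one_ne_zero
  exact hconst.mpullback_vectorField (n := ω)
    (contMDiffAt_of_mem_maximalAtlas (IsManifold.subset_maximalAtlas he) hx)
    ⟨(mdifferentiable_of_mem_atlas he).mfderiv hx, rfl⟩ le_top

theorem symmL_trivializationAt_tangentSpace_single
    (hx : x ∈ (chartAt (Fin n → ℂ) x₀).source) (i : Fin n) :
    (trivializationAt (Fin n → ℂ) (TangentSpace 𝓘(ℂ, Fin n → ℂ)) x₀).symmL ℂ x (Pi.single i 1) =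
      coordField (chartAt (Fin n → ℂ) x₀) i x := by
  let t := trivializationAt (Fin n → ℂ) (TangentSpace 𝓘(ℂ, Fin n → ℂ)) x₀
  have h : (mfderiv 𝓘(ℂ, Fin n → ℂ) 𝓘(ℂ, Fin n → ℂ) (chartAt (Fin n → ℂ) x₀) x).inverse =
      t.symmL ℂ x :=
    calc _ = (t.continuousLinearMapAt ℂ x).inverse :=
          congrArg _ (TangentBundle.continuousLinearMapAt_trivializationAt hx).symm
      _ = t.symmL ℂ x := ContinuousLinearMap.inverse_eq
          (ContinuousLinearMap.ext (t.continuousLinearMapAt_symmL hx))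
          (ContinuousLinearMap.ext (t.symmL_continuousLinearMapAt hx))
  exact congr($h.symm (Pi.single i 1))

theorem trivializationAt_altBundle_apply_single (hx : x ∈ (chartAt (Fin n → ℂ) x₀).source)
    (α : AltFiber n k M x) (J : Fin k → Fin n) :
    (trivializationAt (AltModel n k) (AltFiber n k M) x₀ ⟨x, α⟩).2 (fun j => Pi.single (J j) 1) =
      α fun j => coordField (chartAt (Fin n → ℂ) x₀) (J j) x := by
  have h : (trivializationAt ℂ (Trivial M ℂ) x₀).continuousLinearMapAt ℂ x = .id ℂ ℂ :=
    Trivial.continuousLinearMapAt_trivialization ..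
  simp only [← symmL_trivializationAt_tangentSpace_single hx,
    FiberBundle.trivializationAt_continuousAlternatingMap_apply,
    ContinuousAlternatingMap.inCoordinates, h]
  rfl

end CoordinateFields

/-! ### Coefficients of differential forms -/

section Coefficients

variable {n k : ℕ} {M : Type u} [TopologicalSpace M] [ChartedSpace (Fin n → ℂ) M]
  {e : OpenPartialHomeomorph M (Fin n → ℂ)} {x : M}

instance instT2SpaceTangentSpace : T2Space (TangentSpace 𝓘(ℂ, Fin n → ℂ) x) :=
  inferInstanceAs (T2Space (Fin n → ℂ))

instance instFiniteDimensionalTangentSpace :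
    FiniteDimensional ℂ (TangentSpace 𝓘(ℂ, Fin n → ℂ) x) :=
  inferInstanceAs (FiniteDimensional ℂ (Fin n → ℂ))

/-- The identification of the fibres at `x` of the two sheaves of forms. -/
def fiberEquiv (x : M) : ExtFiber n k M x ≃ₗ[ℂ] AltFiber n k M x :=
  wedgeEquivAlternating ℂ (TangentSpace 𝓘(ℂ, Fin n → ℂ) x) k

/-- The coefficient `α (∂/∂z^{i₁}, …, ∂/∂z^{i_k})` of an alternating form `α` with respect to a
chart `e = (z¹, …, zⁿ)`. -/
def coordCoeff (e : OpenPartialHomeomorph M (Fin n → ℂ)) (I : Fin k ↪o Fin n)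
    (α : AltFiber n k M x) : ℂ :=
  α fun j => coordField e (I j) x

variable (k) in
/-- The basis of `⋀ᵏ (T_x M)*` formed by the `dz^{i₁} ∧ ⋯ ∧ dz^{i_k}`, `i₁ < ⋯ < i_k`. -/
def dzWedgeBasis (he : e.MDifferentiable 𝓘(ℂ, Fin n → ℂ) 𝓘(ℂ, Fin n → ℂ)) (hx : x ∈ e.source) :
    Basis (Fin k ↪o Fin n) ℂ (ExtFiber n k M x) :=
  wedgeBasis k (coordBasis he hx).dualBasis

theorem dzWedgeBasis_apply (he : e.MDifferentiable 𝓘(ℂ, Fin n → ℂ) 𝓘(ℂ, Fin n → ℂ))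
    (hx : x ∈ e.source) (I : Fin k ↪o Fin n) : dzWedgeBasis k he hx I = dzWedge e I x := by
  have h (i : Fin n) : (coordBasis he hx).dualBasis i = dz e i x := by
    rw [Basis.coe_dualBasis, coordBasis_coord]
  exact (wedgeBasis_apply _ I).trans
    (congrArg (exteriorPower.ιMulti ℂ k) (funext fun j => h (I j)))

theorem dzWedgeBasis_repr_apply (he : e.MDifferentiable 𝓘(ℂ, Fin n → ℂ) 𝓘(ℂ, Fin n → ℂ))
    (hx : x ∈ e.source) (w : ExtFiber n k M x) (I : Fin k ↪o Fin n) :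
    (dzWedgeBasis k he hx).repr w I = coordCoeff e I (fiberEquiv x w) :=
  calc (dzWedgeBasis k he hx).repr w I
      = fiberEquiv x w fun j => coordBasis he hx (I j) :=
        (wedgeEquivAlternating_apply_basis _ w I).symm
    _ = coordCoeff e I (fiberEquiv x w) := by
        simp only [coordBasis_apply]
        rfl

theorem sum_coordCoeff_smul_dzWedge (he : e.MDifferentiable 𝓘(ℂ, Fin n → ℂ) 𝓘(ℂ, Fin n → ℂ))
    (hx : x ∈ e.source) (w : ExtFiber n k M x) :
    ∑ I : Fin k ↪o Fin n, coordCoeff e I (fiberEquiv x w) • dzWedge e I x = w := by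
  simp only [← dzWedgeBasis_repr_apply he hx, ← dzWedgeBasis_apply he hx, Basis.sum_repr]

theorem coordCoeff_fiberEquiv_sum_smul_dzWedge
    (he : e.MDifferentiable 𝓘(ℂ, Fin n → ℂ) 𝓘(ℂ, Fin n → ℂ)) (hx : x ∈ e.source)
    (f : (Fin k ↪o Fin n) → ℂ) (I : Fin k ↪o Fin n) :
    coordCoeff e I (fiberEquiv x (∑ J, f J • dzWedge e J x)) = f I := by
  simp only [← dzWedgeBasis_repr_apply he hx, ← dzWedgeBasis_apply he hx, Basis.repr_sum_self]

variable [IsManifold 𝓘(ℂ, Fin n → ℂ) ω M] {U : Opens M}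

theorem isHolSection_iff_coordCoeff {s : (x : U) → AltFiber n k M x} :
    IsHolSection s ↔ ∀ e ∈ atlas (Fin n → ℂ) M, ∀ p : U, (p : M) ∈ e.source →
      ∀ I : Fin k ↪o Fin n, MDifferentiableAt 𝓘(ℂ, Fin n → ℂ) 𝓘(ℂ, ℂ)
        (fun x : U => coordCoeff e I (s x)) p := by
  constructor
  · intro hs e he p hp I
    have hval : MDifferentiableAt 𝓘(ℂ, Fin n → ℂ) 𝓘(ℂ, Fin n → ℂ) (Subtype.val : U → M) p :=
      (contMDiff_subtype_val (n := 1) p).mdifferentiableAt one_ne_zero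
    have happly := mdifferentiableAt_alternating_bundle_apply
      (E₁ := TangentSpace 𝓘(ℂ, Fin n → ℂ)) (E₂ := Trivial M ℂ) (F₂ := ℂ) (hs p)
      fun j => (mdifferentiableAt_coordField he hp (I j)).comp p hval
    simp only [mdifferentiableAt_totalSpace] at happly
    exact happly.2
  · intro hs
    refine (isHolSection_iff s).2 fun p => mdifferentiableAt_alternating_of_apply_basis
      (Pi.basisFun ℂ (Fin n)) fun I => ?_
    refine (hs _ (chart_mem_atlas _ (p : M)) p (mem_chart_source _ _) I).congr_of_eventuallyEq ?_
    filter_upwards [continuous_subtype_val.continuousAt.eventually_mem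
      (chart_source_mem_nhds (Fin n → ℂ) (p : M))] with x hx
    simp only [Pi.basisFun_apply]
    exact trivializationAt_altBundle_apply_single hx (s x) I

theorem isHolForm_iff_coordCoeff {s : (x : U) → ExtFiber n k M x} :
    IsHolForm s ↔ ∀ e ∈ atlas (Fin n → ℂ) M, ∀ p : U, (p : M) ∈ e.source →
      ∀ I : Fin k ↪o Fin n, MDifferentiableAt 𝓘(ℂ, Fin n → ℂ) 𝓘(ℂ, ℂ)
        (fun x : U => coordCoeff e I (fiberEquiv (x : M) (s x))) p := by
  refine ⟨fun hs e he p hp I => ?_, fun hs e he p hp => ?_⟩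
  · obtain ⟨V, hV, hpV, hVe, f, hf⟩ := hs e he p hp
    have hfI : (fun x : U => coordCoeff e I (fiberEquiv (x : M) (s x))) ∘ Set.inclusion hV =
        (f I).1 := funext fun x => by
      rw [← coordCoeff_fiberEquiv_sum_smul_dzWedge (mdifferentiable_of_mem_atlas he) (hVe x.2)
        (fun J => (f J).1 x) I, ← hf x]
      rfl
    refine (differentiableWithinAt_localInvariantProp.liftPropAt_iff_comp_inclusion hV _
      ⟨p, hpV⟩).2 ?_
    rw [hfI]
    exact (f I).2 ⟨p, hpV⟩
  · let V : Opens M := U ⊓ ⟨e.source, e.open_source⟩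
    have hV : V ≤ U := inf_le_left
    have hcoeff (I : Fin k ↪o Fin n) : MDifferentiable 𝓘(ℂ, Fin n → ℂ) 𝓘(ℂ, ℂ)
        fun x : V => coordCoeff e I (fiberEquiv (x : M) (s (Set.inclusion hV x))) := fun x =>
      (differentiableWithinAt_localInvariantProp.liftPropAt_iff_comp_inclusion hV _ x).1
        (hs e he (Set.inclusion hV x) x.2.2 I)
    exact ⟨V, hV, ⟨p.2, hp⟩, fun _ hx => hx.2, fun I => ⟨_, hcoeff I⟩, fun x =>
      (sum_coordCoeff_smul_dzWedge (mdifferentiable_of_mem_atlas he) x.2.2 _).symm⟩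

end Coefficients

/-! ### Isomorphisms of sheaves of modules induced by fibrewise isomorphisms -/

section LocalModuleIso

variable {n : ℕ} {M : Type u} [TopologicalSpace M] [ChartedSpace (Fin n → ℂ) M]
  {T T' : M → Type} [∀ x, AddCommGroup (T x)] [∀ x, Module ℂ (T x)]
  [∀ x, AddCommGroup (T' x)] [∀ x, Module ℂ (T' x)]

/-- The isomorphism of modules of sections over `U` induced by fibrewise isomorphisms `Φ` that
match the sections of two local modules. -/
def LocalModule.secEquiv (F : LocalModule n M T) (G : LocalModule n M T')
    (Φ : ∀ x, T x ≃ₗ[ℂ] T' x) {U : Opens M}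
    (h : ∀ s : (x : U) → T x, (fun x : U => Φ x (s x)) ∈ G.sec U ↔ s ∈ F.sec U) :
    F.sec U ≃ₗ[holRing n M U] G.sec U where
  toFun s := ⟨fun x => Φ x (s.1 x), (h s.1).2 s.2⟩
  invFun t := ⟨fun x => (Φ x).symm (t.1 x), (h _).1 (by simp)⟩
  map_add' s t := Subtype.ext (funext fun x => (Φ x).map_add (s.1 x) (t.1 x))
  map_smul' f s := Subtype.ext (funext fun x => (Φ x).map_smul (f.1 x) (s.1 x))
  left_inv s := by ext; simp
  right_inv t := by ext; simp

/-- The isomorphism of sheaves of modules induced by fibrewise isomorphisms `Φ` that match the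
sections of two local modules over all open subsets. -/
def LocalModule.isoOfFiberEquiv (F : LocalModule n M T) (G : LocalModule n M T')
    (Φ : ∀ x, T x ≃ₗ[ℂ] T' x)
    (h : ∀ (U : Opens M) (s : (x : U) → T x), (fun x : U => Φ x (s x)) ∈ G.sec U ↔ s ∈ F.sec U) :
    F.toSheaf ≅ G.toSheaf :=
  (SheafOfModules.fullyFaithfulForget (structureSheaf n M)).preimageIso
    (PresheafOfModules.isoMk
      (fun U => LinearEquiv.toModuleIso (R := (structureSheaf n M).obj.obj U)
        (F.secEquiv G Φ (h (unop U))))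
      (fun _ _ _ => rfl))

end LocalModuleIso

end HolForms

end

theorem theorem23_general (n k : ℕ) (M : Type*) [TopologicalSpace M]
    [ChartedSpace (Fin n → ℂ) M] [IsManifold 𝓘(ℂ, Fin n → ℂ) ω M] :
    Nonempty (HolForms.altFormSheaf n k M ≅ HolForms.classicalFormSheaf n k M) :=
  ⟨(HolForms.LocalModule.isoOfFiberEquiv (HolForms.holForms n k M) (HolForms.altForms n k M)
    HolForms.fiberEquiv fun _ _ => HolForms.isHolSection_iff_coordCoeff.trans
      HolForms.isHolForm_iff_coordCoeff.symm).symm⟩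

theorem theorem23 (n k : ℕ) (M : Type*) [TopologicalSpace M] [T2Space M]
    [ChartedSpace (Fin n → ℂ) M] [IsManifold 𝓘(ℂ, Fin n → ℂ) ω M] :
    Nonempty (HolForms.altFormSheaf n k M ≅ HolForms.classicalFormSheaf n k M) :=
  theorem23_general n k M
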